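/- For graphs $H, G$ let $\mathcal N(H,G)$ be the number of subgraphs of $G$ isomorphic to $H$ (not necessarily induced), and let $\mathrm{ex}(n,H,F)$ be the maximum of $\mathcal N(H,G)$ over all $F$-free graphs $G$ on $n$ vertices. Let $T_r(n)$ be the Turán graph, that is, the complete $r$-partite graph on $n$ vertices with every part of size $\lfloor n/r\rfloor$ or $\lceil n/r\rceil$. If $F$ has chromatic number $k\ge 2$ and $H$ does not contain $F$, then $H$ is called $F$-Turán-good if $\mathrm{ex}(n,H,F)=\mathcal N(H,T_{k-1}(n))$ for every sufficiently large $n$; $K_k$-Turán-good is abbreviated to $k$-Turán-good. **Proposition.** The path $P_4$ on four vertices (with three edges) is $4$-Turán-good. That is, there is $n_0$ such that for every $n\ge n_0$, $$\mathrm{ex}(n,P_4,K_4)=\mathcal N(P_4,T_3(n)).$$ -/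

import Mathlib

open SimpleGraph

open scoped Classical in
/-- The generalized Turán number `ex(n, H, F)`: the largest number of (unlabelled, not necessarily
induced) copies of `H` in an `F`-free graph on `n` vertices. Here `F.Free G` says that `G` contains
no copy of `F` and `G.copyCount H` is the number of subgraphs of `G` isomorphic to `H`. -/
noncomputable def genTuranNumber {V W : Type*} (n : ℕ) (H : SimpleGraph V) (F : SimpleGraph W) :
    ℕ :=
  (Finset.univ.filter fun G : SimpleGraph (Fin n) => F.Free G).sup fun G => G.copyCount H

/-- `H` is `F`-Turán-good: `F` has chromatic number `k` (with `k ≥ 2`, so that the Turán graph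
with `k - 1` parts makes sense), `H` does not contain `F`, and for every large enough `n` we have
`ex(n, H, F) = N(H, T_{k-1}(n))`. -/
def IsTuranGood {V W : Type*} (F : SimpleGraph W) (H : SimpleGraph V) : Prop :=
  ∃ k : ℕ, 2 ≤ k ∧ F.chromaticNumber = k ∧ F.Free H ∧
    ∃ n₀ : ℕ, ∀ n : ℕ, n₀ ≤ n →
      genTuranNumber n H F = (turanGraph n (k - 1)).copyCount H

/-- `H` is `k`-Turán-good: it is `K_k`-Turán-good. -/
def IsKTuranGood {V : Type*} (k : ℕ) (H : SimpleGraph V) : Prop :=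
  IsTuranGood (completeGraph (Fin k)) H

/-! The argument is Zykov symmetrization. Labelled and unlabelled counts differ by the constant
factor `|Aut P₄|`, so it suffices to maximise the number of injective three-edge walks, which
`pathSum` expresses through the adjacency matrix.

Take a `K₄`-free graph `M` maximising `pathSum`. Replacing one of two nonadjacent vertices by a copy
of the other keeps the graph `K₄`-free. By `pathSum_lt_of_not_adj`, the two possible replacements
together gain strictly, unless the vertices are already twins or both have degree at most two. Hence
in `M` nonadjacent vertices are twins as soon as one has degree at least three.

If every degree is at least three, nonadjacency is transitive, so `M` is complete multipartite with
at most three parts, and smoothing the part sizes (`tripartitePathCount_le`) gives the Turán graph.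
If some vertex has degree at most two, every vertex of degree at least three is adjacent to it.
There are then at most two of these, and the count is `O(n³)`, below the order `n⁴` of the Turán
graph. -/

namespace SimpleGraph

open Finset

/-! ### Labelled and unlabelled copies. -/

section CopyCount

variable {V W : Type*} [Fintype V] [Fintype W]

open scoped Classical in
/-- Every unlabelled copy of `H` carries exactly `|Aut H|` labellings. -/
theorem labelledCopyCount_eq_copyCount_mul (G : SimpleGraph V) (H : SimpleGraph W) :
    G.labelledCopyCount H = G.copyCount H * Nat.card (H ≃g H) := by
  rw [labelledCopyCount, Fintype.card_eq_nat_card, ← Fintype.card_eq_nat_card, ← Finset.card_univ,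
    copyCount_eq_card_image_copyToSubgraph, ← smul_eq_mul, ← sum_const,
    card_eq_sum_card_image Copy.toSubgraph univ]
  refine sum_congr rfl fun G' hG' ↦ ?_
  obtain ⟨f₀, -, rfl⟩ := mem_image.1 hG'
  rw [← Fintype.card_subtype, Fintype.card_eq_nat_card]
  have hF (φ : H ≃g H) : (f₀.comp φ.toCopy).toSubgraph = f₀.toSubgraph := by
    ext x y
    · constructor
      · rintro ⟨a, -, rfl⟩
        exact ⟨φ a, trivial, rfl⟩
      · rintro ⟨a, -, rfl⟩
        exact ⟨φ.symm a, trivial, by simp⟩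
    · constructor
      · rintro ⟨a, b, h, rfl, rfl⟩
        exact ⟨φ a, φ b, φ.map_adj_iff.2 h, rfl, rfl⟩
      · rintro ⟨a, b, h, rfl, rfl⟩
        exact ⟨φ.symm a, φ.symm b, φ.symm.map_adj_iff.2 h, by simp, by simp⟩
  symm
  refine Nat.card_eq_of_bijective
    (fun φ : H ≃g H ↦ (⟨f₀.comp φ.toCopy, by simpa using hF φ⟩ :
      {f : Copy H G // f.toSubgraph = f₀.toSubgraph})) ⟨fun φ ψ h ↦ ?_, ?_⟩
  · ext x
    exact f₀.injective (DFunLike.congr_fun (Subtype.ext_iff.1 h) x)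
  -- Two labellings with the same image subgraph differ by an automorphism `φ` of `H`, read off
  -- vertex by vertex.
  · rintro ⟨f, hf⟩
    have hv (x : W) : ∃ y, f₀ y = f x := by
      have : f x ∈ f.toSubgraph.verts := by simp
      rw [hf] at this
      simpa using this
    choose φ hφ using hv
    have hφi : Function.Injective φ := fun x y h ↦
      f.injective (show f x = f y by rw [← hφ, ← hφ, h])
    have had (x y : W) : H.Adj (φ x) (φ y) ↔ H.Adj x y := by
      have key (g : Copy H G) (x y : W) : g.toSubgraph.Adj (g x) (g y) ↔ H.Adj x y := by
        constructor
        · rintro ⟨a, b, h, h1, h2⟩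
          rwa [← g.injective h1, ← g.injective h2]
        · exact fun h ↦ ⟨x, y, h, rfl, rfl⟩
      rw [← key f₀, ← key f, hφ, hφ, hf]
    refine ⟨⟨Equiv.ofBijective φ (Finite.injective_iff_bijective.1 hφi), had _ _⟩, ?_⟩
    ext x
    exact hφ x

theorem copyCount_le_copyCount_iff {U : Type*} [Fintype U] (G : SimpleGraph V) (G' : SimpleGraph U)
    (H : SimpleGraph W) :
    G.copyCount H ≤ G'.copyCount H ↔ G.labelledCopyCount H ≤ G'.labelledCopyCount H := by
  have : Nonempty (H ≃g H) := ⟨Iso.refl⟩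
  have : Finite (H ≃g H) := Finite.of_injective _ (DFunLike.coe_injective (F := H ≃g H))
  rw [labelledCopyCount_eq_copyCount_mul, labelledCopyCount_eq_copyCount_mul,
    Nat.mul_le_mul_right_iff Nat.card_pos]

end CopyCount

section AdjInd

variable {V : Type*}

open scoped Classical in
/-- The adjacency indicator of a graph, with integer values. -/
noncomputable def adjInd (G : SimpleGraph V) (x y : V) : ℤ := if G.Adj x y then 1 else 0

lemma adjInd_congr {W : Type*} {G : SimpleGraph V} {G' : SimpleGraph W} {x y : V} {x' y' : W}
    (h : G.Adj x y ↔ G'.Adj x' y') : adjInd G x y = adjInd G' x' y' := by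
  classical exact if_congr h rfl rfl

lemma adjInd_comm (G : SimpleGraph V) (x y : V) : adjInd G x y = adjInd G y x :=
  adjInd_congr (G.adj_comm x y)

lemma adjInd_self (G : SimpleGraph V) (x : V) : adjInd G x x = 0 := by
  simp [adjInd]

lemma adjInd_eq_zero_or_one (G : SimpleGraph V) (x y : V) : adjInd G x y = 0 ∨ adjInd G x y = 1 := by
  unfold adjInd; split_ifs <;> simp

lemma adjInd_nonneg (G : SimpleGraph V) (x y : V) : 0 ≤ adjInd G x y := by
  unfold adjInd; split_ifs <;> simp

end AdjInd

/-! ### A closed formula for three-edge paths. -/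

section PathCount

variable {V : Type*} [Fintype V]

/-- The closed form for the number of injective walks with three edges, for a weighted
adjacency matrix `A`. -/
def pathSum (A : V → V → ℤ) : ℤ :=
  (∑ x, ∑ y, A x y * ((∑ z, A x z) * ∑ z, A y z)) - 2 * (∑ x, (∑ z, A x z) ^ 2)
    + (∑ x, ∑ z, A x z) - ∑ x, ∑ y, ∑ z, A x y * A y z * A z x

open scoped Classical in
lemma labelledCopyCount_pathGraph_four_eq_sum (G : SimpleGraph V) :
    (G.labelledCopyCount (pathGraph 4) : ℤ) =
      ∑ b, ∑ c, ∑ a, ∑ d, adjInd G a b * adjInd G b c * adjInd G c d *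
        ((if a = c then 0 else 1) * (if b = d then 0 else 1) * (if a = d then 0 else 1)) := by
  have e : Copy (pathGraph 4) G ≃ {p : V × V × V × V // G.Adj p.2.2.1 p.1 ∧ G.Adj p.1 p.2.1 ∧
      G.Adj p.2.1 p.2.2.2 ∧ p.2.2.1 ≠ p.2.1 ∧ p.1 ≠ p.2.2.2 ∧ p.2.2.1 ≠ p.2.2.2} :=
    { toFun f := ⟨(f 1, f 2, f 0, f 3),
        f.toHom.map_adj (by simp [pathGraph_adj]), f.toHom.map_adj (by simp [pathGraph_adj]),
        f.toHom.map_adj (by simp [pathGraph_adj]), f.injective.ne (by decide),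
        f.injective.ne (by decide), f.injective.ne (by decide)⟩
      invFun p := ⟨⟨![p.1.2.2.1, p.1.1, p.1.2.1, p.1.2.2.2], by
          obtain ⟨⟨b, c, a, d⟩, h1, h2, h3, -⟩ := p
          intro i j h
          rw [pathGraph_adj] at h
          fin_cases i <;> fin_cases j <;> simp at h <;>
            first
            | exact h1 | exact h2 | exact h3 | exact h1.symm | exact h2.symm | exact h3.symm⟩, by
          obtain ⟨⟨b, c, a, d⟩, h1, h2, h3, h4, h5, h6⟩ := p
          have := h1.ne
          have := h2.ne
          have := h3.ne
          intro i j h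
          fin_cases i <;> fin_cases j <;> simp at h <;> simp_all⟩
      left_inv f := by
        ext i
        fin_cases i <;> rfl
      right_inv p := rfl }
  rw [labelledCopyCount, Fintype.card_eq_nat_card, Nat.card_congr e, Nat.card_eq_fintype_card,
    Fintype.card_subtype, Finset.card_filter]
  push_cast
  simp only [Fintype.sum_prod_type]
  refine sum_congr rfl fun b _ ↦ sum_congr rfl fun c _ ↦ sum_congr rfl fun a _ ↦
    sum_congr rfl fun d _ ↦ ?_
  unfold adjInd
  split_ifs <;> simp_all

/-- Inclusion–exclusion over walks `a b c d` with fixed middle edge `bc`. The coincidences `a = c`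
and `b = d` each cost a sum of squared degrees and jointly give back the edge `bc`; `a = d` costs
the triangles. The other overlaps would need a loop. -/
theorem labelledCopyCount_pathGraph_four (G : SimpleGraph V) :
    (G.labelledCopyCount (pathGraph 4) : ℤ) = pathSum (adjInd G) := by
  classical
  rw [labelledCopyCount_pathGraph_four_eq_sum]
  have key : ∀ b c, ∑ a, ∑ d, adjInd G a b * adjInd G b c * adjInd G c d *
        ((if a = c then 0 else 1) * (if b = d then 0 else 1) * (if a = d then 0 else 1)) =
      adjInd G b c * ((∑ z, adjInd G b z) * ∑ z, adjInd G c z)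
      - adjInd G c b * (∑ z, adjInd G c z) - adjInd G b c * (∑ z, adjInd G b z)
      + adjInd G b c - ∑ z, adjInd G b c * adjInd G c z * adjInd G z b := by
    intro b c
    have h : ∀ a d, adjInd G a b * adjInd G b c * adjInd G c d *
        ((if a = c then 0 else 1) * (if b = d then 0 else 1) * (if a = d then 0 else 1)) =
        adjInd G b c * (adjInd G b a * adjInd G c d)
        - (if a = c then adjInd G c b * adjInd G c d else 0)
        - (if d = b then adjInd G b c * adjInd G b a else 0)
        + (if a = c then (if d = b then adjInd G b c else 0) else 0)
        - (if d = a then adjInd G b c * adjInd G c a * adjInd G a b else 0) := by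
      intro a d
      have h0 := adjInd_self G
      have h1 := adjInd_comm G a b
      have h2 := adjInd_comm G c b
      have h3 := adjInd_comm G c a
      rcases adjInd_eq_zero_or_one G b c with hbc | hbc <;> grind
    have h2 (a : V) : ∑ d, (if a = c then adjInd G c b * adjInd G c d else 0) =
        if a = c then adjInd G c b * ∑ d, adjInd G c d else 0 := by
      split_ifs <;> simp [mul_sum]
    have h3 (a : V) : ∑ d, (if a = c then (if d = b then adjInd G b c else 0) else 0) =
        if a = c then adjInd G b c else 0 := by
      split_ifs <;> simp
    simp only [h, sum_sub_distrib, sum_add_distrib, h2, h3, sum_ite_eq', mem_univ, if_true,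
      ← mul_sum, ← sum_mul]
  simp only [key, pathSum, sum_sub_distrib, sum_add_distrib]
  have h1 : ∑ b, ∑ c, adjInd G c b * (∑ z, adjInd G c z) = ∑ x, (∑ z, adjInd G x z) ^ 2 := by
    rw [sum_comm]
    simp only [← sum_mul, sq]
  have h2 : ∑ b, ∑ c, adjInd G b c * (∑ z, adjInd G b z) = ∑ x, (∑ z, adjInd G x z) ^ 2 := by
    simp only [← sum_mul, sq]
  rw [h1, h2]
  ring

end PathCount

/-! ### Symmetrizing two nonadjacent vertices. -/

section Symmetrization

variable {V : Type*}

/-- Closed form of `pathSum` for a weighted graph obtained from the weights `B` on `S` by adding two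
nonadjacent vertices whose rows are `f` and `g`. -/
def pathSumAux (S : Finset V) (B : V → V → ℤ) (f g : V → ℤ) : ℤ :=
  (2 * (∑ x ∈ S, f x) * (∑ x ∈ S, f x * (f x + g x + ∑ z ∈ S, B x z))
    + 2 * (∑ x ∈ S, g x) * (∑ x ∈ S, g x * (f x + g x + ∑ z ∈ S, B x z))
    + ∑ x ∈ S, ∑ y ∈ S,
        B x y * ((f x + g x + ∑ z ∈ S, B x z) * (f y + g y + ∑ z ∈ S, B y z)))
  - 2 * ((∑ x ∈ S, f x) ^ 2 + (∑ x ∈ S, g x) ^ 2 + ∑ x ∈ S, (f x + g x + ∑ z ∈ S, B x z) ^ 2)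
  + (2 * (∑ x ∈ S, f x) + 2 * (∑ x ∈ S, g x) + ∑ x ∈ S, ∑ z ∈ S, B x z)
  - (3 * (∑ x ∈ S, ∑ y ∈ S, B x y * (f x * f y)) + 3 * (∑ x ∈ S, ∑ y ∈ S, B x y * (g x * g y))
    + ∑ x ∈ S, ∑ y ∈ S, ∑ z ∈ S, B x y * B y z * B z x)

lemma sum_eq_add_add_sum_erase [Fintype V] [DecidableEq V] {u v : V} (huv : u ≠ v) (h : V → ℤ) :
    ∑ x, h x = h u + h v + ∑ x ∈ (univ.erase u).erase v, h x := by
  rw [add_assoc, add_sum_erase _ _ (by simp [huv.symm]), add_sum_erase _ _ (mem_univ u)]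

/-- Isolates the dependence on the rows of `u` and `v`: the original graph and both replacements
share `S` and `B`, with rows `(f, g)`, `(f, f)` and `(g, g)`. -/
theorem pathSum_eq_pathSumAux [Fintype V] [DecidableEq V] {u v : V} (huv : u ≠ v) {A B : V → V → ℤ}
    {f g : V → ℤ} (hA : ∀ x y, A x y = A y x) (huu : A u u = 0) (hvv : A v v = 0)
    (hAuv : A u v = 0)
    (hf : ∀ x ∈ (univ.erase u).erase v, A x u = f x)
    (hg : ∀ x ∈ (univ.erase u).erase v, A x v = g x)
    (hB : ∀ x ∈ (univ.erase u).erase v, ∀ y ∈ (univ.erase u).erase v, A x y = B x y) :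
    pathSum A = pathSumAux ((univ.erase u).erase v) B f g := by
  set S := (univ.erase u).erase v
  have hf' (x) (hx : x ∈ S) : A u x = f x := by rw [hA, hf x hx]
  have hg' (x) (hx : x ∈ S) : A v x = g x := by rw [hA, hg x hx]
  have hAvu : A v u = 0 := by rw [hA, hAuv]
  have hdu : ∑ z, A u z = ∑ x ∈ S, f x := by
    rw [sum_eq_add_add_sum_erase huv, huu, hAuv, sum_congr rfl hf']; ring
  have hdv : ∑ z, A v z = ∑ x ∈ S, g x := by
    rw [sum_eq_add_add_sum_erase huv, hvv, hAvu, sum_congr rfl hg']; ring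
  have hd (x) (hx : x ∈ S) : ∑ z, A x z = f x + g x + ∑ z ∈ S, B x z := by
    rw [sum_eq_add_add_sum_erase huv, hf x hx, hg x hx, sum_congr rfl (hB x hx)]
  have h1 : ∑ x, ∑ y, A x y * ((∑ z, A x z) * ∑ z, A y z) =
      2 * (∑ x ∈ S, f x) * (∑ x ∈ S, f x * (f x + g x + ∑ z ∈ S, B x z))
      + 2 * (∑ x ∈ S, g x) * (∑ x ∈ S, g x * (f x + g x + ∑ z ∈ S, B x z))
      + ∑ x ∈ S, ∑ y ∈ S,
        B x y * ((f x + g x + ∑ z ∈ S, B x z) * (f y + g y + ∑ z ∈ S, B y z)) := by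
    have e1 : ∑ y, A u y * ((∑ z, A u z) * ∑ z, A y z) =
        (∑ x ∈ S, f x) * (∑ x ∈ S, f x * (f x + g x + ∑ z ∈ S, B x z)) := by
      have e (x) (hx : x ∈ S) : A u x * ((∑ x ∈ S, f x) * ∑ z, A x z) =
          (∑ x ∈ S, f x) * (f x * (f x + g x + ∑ z ∈ S, B x z)) := by
        rw [hf' x hx, hd x hx]; ring
      rw [sum_eq_add_add_sum_erase huv, huu, hAuv, hdu, zero_mul, zero_mul, zero_add,
        zero_add, sum_congr rfl e, ← mul_sum]
    have e2 : ∑ y, A v y * ((∑ z, A v z) * ∑ z, A y z) =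
        (∑ x ∈ S, g x) * (∑ x ∈ S, g x * (f x + g x + ∑ z ∈ S, B x z)) := by
      have e (x) (hx : x ∈ S) : A v x * ((∑ x ∈ S, g x) * ∑ z, A x z) =
          (∑ x ∈ S, g x) * (g x * (f x + g x + ∑ z ∈ S, B x z)) := by
        rw [hg' x hx, hd x hx]; ring
      rw [sum_eq_add_add_sum_erase huv, hvv, hAvu, hdv, zero_mul, zero_mul, zero_add,
        zero_add, sum_congr rfl e, ← mul_sum]
    have e3 (x) (hx : x ∈ S) : ∑ y, A x y * ((∑ z, A x z) * ∑ z, A y z) =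
        (∑ x ∈ S, f x) * (f x * (f x + g x + ∑ z ∈ S, B x z))
        + (∑ x ∈ S, g x) * (g x * (f x + g x + ∑ z ∈ S, B x z))
        + ∑ y ∈ S, B x y * ((f x + g x + ∑ z ∈ S, B x z) * (f y + g y + ∑ z ∈ S, B y z)) := by
      rw [sum_eq_add_add_sum_erase huv, hdu, hdv, hf x hx, hg x hx, hd x hx]
      have e (y) (hy : y ∈ S) : A x y * ((f x + g x + ∑ z ∈ S, B x z) * ∑ z, A y z) =
          B x y * ((f x + g x + ∑ z ∈ S, B x z) * (f y + g y + ∑ z ∈ S, B y z)) := by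
        rw [hB x hx y hy, hd y hy]
      rw [sum_congr rfl e]
      ring
    rw [sum_eq_add_add_sum_erase huv, e1, e2, sum_congr rfl e3, sum_add_distrib, sum_add_distrib,
      ← mul_sum, ← mul_sum]
    ring
  have h2 : ∑ x, (∑ z, A x z) ^ 2 =
      (∑ x ∈ S, f x) ^ 2 + (∑ x ∈ S, g x) ^ 2 + ∑ x ∈ S, (f x + g x + ∑ z ∈ S, B x z) ^ 2 := by
    have e (x) (hx : x ∈ S) : (∑ z, A x z) ^ 2 = (f x + g x + ∑ z ∈ S, B x z) ^ 2 := by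
      rw [hd x hx]
    rw [sum_eq_add_add_sum_erase huv, hdu, hdv, sum_congr rfl e]
  have h3 : ∑ x, ∑ z, A x z =
      2 * (∑ x ∈ S, f x) + 2 * (∑ x ∈ S, g x) + ∑ x ∈ S, ∑ z ∈ S, B x z := by
    rw [sum_eq_add_add_sum_erase huv, hdu, hdv, sum_congr rfl hd, sum_add_distrib, sum_add_distrib]
    ring
  have h4 : ∑ x, ∑ y, ∑ z, A x y * A y z * A z x =
      3 * (∑ x ∈ S, ∑ y ∈ S, B x y * (f x * f y)) + 3 * (∑ x ∈ S, ∑ y ∈ S, B x y * (g x * g y))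
      + ∑ x ∈ S, ∑ y ∈ S, ∑ z ∈ S, B x y * B y z * B z x := by
    have hBs (x) (hx : x ∈ S) (y) (hy : y ∈ S) : B x y = B y x := by
      rw [← hB x hx y hy, ← hB y hy x hx, hA]
    have t1 (x y) (hy : y ∈ S) : ∑ z, A x y * A y z * A z x =
        A x y * f y * A u x + A x y * g y * A v x + ∑ z ∈ S, A x y * B y z * A z x := by
      rw [sum_eq_add_add_sum_erase huv, hf y hy, hg y hy,
        sum_congr rfl fun z hz ↦ by rw [hB y hy z hz]]
    have t2 (w : V) (h : V → ℤ) (hw : ∀ x ∈ S, A x w = h x) (hw' : ∀ x ∈ S, A w x = h x)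
        (hwu : A w u = 0) (hwv : A w v = 0) :
        ∑ y, ∑ z, A w y * A y z * A z w = ∑ x ∈ S, ∑ y ∈ S, B x y * (h x * h y) := by
      rw [sum_eq_add_add_sum_erase huv, hwu, hwv]
      simp only [zero_mul, sum_const_zero, zero_add]
      refine sum_congr rfl fun y hy ↦ ?_
      rw [t1 w y hy, hA u w, hA v w, hwu, hwv, mul_zero, mul_zero, zero_add, zero_add]
      exact sum_congr rfl fun z hz ↦ by rw [hw' y hy, hw z hz]; ring
    have t3 (x) (hx : x ∈ S) (w : V) (h : V → ℤ) (hw : ∀ x ∈ S, A x w = h x)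
        (hw' : ∀ x ∈ S, A w x = h x) (hwu : A w u = 0) (hwv : A w v = 0) :
        ∑ z, A x w * A w z * A z x = ∑ y ∈ S, B x y * (h x * h y) := by
      rw [sum_eq_add_add_sum_erase huv, hwu, hwv, mul_zero, zero_mul, zero_mul, zero_add, zero_add]
      exact sum_congr rfl fun z hz ↦ by
        rw [hw x hx, hw' z hz, hB z hz x hx, hBs z hz x hx]; ring
    have t4 (x) (hx : x ∈ S) : ∑ y, ∑ z, A x y * A y z * A z x =
        2 * (∑ y ∈ S, B x y * (f x * f y)) + 2 * (∑ y ∈ S, B x y * (g x * g y))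
        + ∑ y ∈ S, ∑ z ∈ S, B x y * B y z * B z x := by
      rw [sum_eq_add_add_sum_erase huv, t3 x hx u f hf hf' huu hAuv, t3 x hx v g hg hg' hAvu hvv]
      have : ∀ y ∈ S, ∑ z, A x y * A y z * A z x = B x y * (f x * f y) + B x y * (g x * g y)
          + ∑ z ∈ S, B x y * B y z * B z x := fun y hy ↦ by
        rw [t1 x y hy, hB x hx y hy, hf' x hx, hg' x hx,
          sum_congr rfl fun z hz ↦ by rw [hB z hz x hx]]
        ring
      rw [sum_congr rfl this, sum_add_distrib, sum_add_distrib]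
      ring
    rw [sum_eq_add_add_sum_erase huv, t2 u f hf hf' huu hAuv, t2 v g hg hg' hAvu hvv,
      sum_congr rfl t4, sum_add_distrib, sum_add_distrib, ← mul_sum, ← mul_sum]
    ring
  rw [pathSum, h1, h2, h3, h4, pathSumAux]

/-- In this second difference every term that splits into a part in `f` and a part in `g` cancels,
the triangles among them. What survives comes from degrees, which involve `f + g`. -/
theorem pathSumAux_add_sub (S : Finset V) (B : V → V → ℤ) (f g : V → ℤ)
    (hf : ∀ x ∈ S, f x = 0 ∨ f x = 1) (hg : ∀ x ∈ S, g x = 0 ∨ g x = 1) :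
    pathSumAux S B f f + pathSumAux S B g g - 2 * pathSumAux S B f g =
      2 * (∑ x ∈ S, ∑ y ∈ S, B x y * ((f x - g x) * (f y - g y)))
      + 4 * ((∑ x ∈ S, f x) * ∑ x ∈ S, f x * (1 - g x))
      + 4 * ((∑ x ∈ S, g x) * ∑ x ∈ S, g x * (1 - f x))
      - 4 * ((∑ x ∈ S, f x * (1 - g x)) + ∑ x ∈ S, g x * (1 - f x)) := by
  have h1 : (∑ x ∈ S, ∑ y ∈ S,
        B x y * ((f x + f x + ∑ z ∈ S, B x z) * (f y + f y + ∑ z ∈ S, B y z)))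
      + (∑ x ∈ S, ∑ y ∈ S,
        B x y * ((g x + g x + ∑ z ∈ S, B x z) * (g y + g y + ∑ z ∈ S, B y z)))
      - 2 * (∑ x ∈ S, ∑ y ∈ S,
        B x y * ((f x + g x + ∑ z ∈ S, B x z) * (f y + g y + ∑ z ∈ S, B y z)))
      = 2 * (∑ x ∈ S, ∑ y ∈ S, B x y * ((f x - g x) * (f y - g y))) := by
    simp only [mul_sum (s := S) (a := (2 : ℤ)), ← sum_add_distrib, ← sum_sub_distrib]
    exact sum_congr rfl fun x _ ↦ sum_congr rfl fun y _ ↦ by ring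
  have h2 : (∑ x ∈ S, (f x + f x + ∑ z ∈ S, B x z) ^ 2)
      + (∑ x ∈ S, (g x + g x + ∑ z ∈ S, B x z) ^ 2)
      - 2 * (∑ x ∈ S, (f x + g x + ∑ z ∈ S, B x z) ^ 2)
      = 2 * ((∑ x ∈ S, f x * (1 - g x)) + ∑ x ∈ S, g x * (1 - f x)) := by
    simp only [mul_sum (s := S) (a := (2 : ℤ)), mul_add (2 : ℤ), ← sum_add_distrib,
      ← sum_sub_distrib]
    refine sum_congr rfl fun x hx ↦ ?_
    rcases hf x hx with h | h <;> rcases hg x hx with h' | h' <;> rw [h, h'] <;> ring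
  have h3 : (∑ x ∈ S, f x * (f x + f x + ∑ z ∈ S, B x z))
      - (∑ x ∈ S, f x * (f x + g x + ∑ z ∈ S, B x z)) = ∑ x ∈ S, f x * (1 - g x) := by
    rw [← sum_sub_distrib]
    refine sum_congr rfl fun x hx ↦ ?_
    rcases hf x hx with h | h <;> rcases hg x hx with h' | h' <;> rw [h, h'] <;> ring
  have h4 : (∑ x ∈ S, g x * (g x + g x + ∑ z ∈ S, B x z))
      - (∑ x ∈ S, g x * (f x + g x + ∑ z ∈ S, B x z)) = ∑ x ∈ S, g x * (1 - f x) := by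
    rw [← sum_sub_distrib]
    refine sum_congr rfl fun x hx ↦ ?_
    rcases hf x hx with h | h <;> rcases hg x hx with h' | h' <;> rw [h, h'] <;> ring
  unfold pathSumAux
  linear_combination h1 - 2 * h2 + 4 * (∑ x ∈ S, f x) * h3 + 4 * (∑ x ∈ S, g x) * h4

/-- A summand is negative only if one of `x`, `y` is a private neighbour of `u` and the other of
`v`. -/
theorem neg_le_sum_sum_mul_sub_mul_sub (S : Finset V) (B : V → V → ℤ) (f g : V → ℤ)
    (hf : ∀ x ∈ S, f x = 0 ∨ f x = 1) (hg : ∀ x ∈ S, g x = 0 ∨ g x = 1)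
    (hB : ∀ x y, B x y = 0 ∨ B x y = 1) :
    -(2 * ((∑ x ∈ S, f x * (1 - g x)) * ∑ x ∈ S, g x * (1 - f x))) ≤
      ∑ x ∈ S, ∑ y ∈ S, B x y * ((f x - g x) * (f y - g y)) := by
  have h : 2 * ((∑ x ∈ S, f x * (1 - g x)) * ∑ x ∈ S, g x * (1 - f x)) =
      ∑ x ∈ S, ∑ y ∈ S, (f x * (1 - g x) * (g y * (1 - f y))
        + g x * (1 - f x) * (f y * (1 - g y))) := by
    simp only [sum_add_distrib, ← mul_sum, ← sum_mul]
    ring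
  rw [h]
  simp only [← sum_neg_distrib]
  refine sum_le_sum fun x hx ↦ sum_le_sum fun y hy ↦ ?_
  rcases hf x hx with h1 | h1 <;> rcases hg x hx with h2 | h2 <;> rcases hf y hy with h3 | h3 <;>
    rcases hg y hy with h4 | h4 <;> rcases hB x y with h5 | h5 <;> rw [h1, h2, h3, h4, h5] <;>
    norm_num

/-- Replacing one of two nonadjacent, non-twin vertices by a copy of the other one strictly increases
the average number of three-edge paths, unless both vertices have degree at most two. -/
theorem pathSum_lt_of_not_adj [Fintype V] [DecidableEq V] (G : SimpleGraph V) {u v : V} (huv : u ≠ v)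
    (hnadj : ¬ G.Adj u v) (hdeg : 3 ≤ ∑ x, adjInd G u x ∨ 3 ≤ ∑ x, adjInd G v x)
    (htwin : ∃ x, ¬ (G.Adj u x ↔ G.Adj v x)) :
    2 * pathSum (adjInd G) <
      pathSum (adjInd (G.replaceVertex u v)) + pathSum (adjInd (G.replaceVertex v u)) := by
  set S := (univ.erase u).erase v with hS
  have hmem {x : V} : x ∈ S ↔ x ≠ u ∧ x ≠ v := by simp [hS, and_comm]
  have hnadj' : ¬ G.Adj v u := fun h ↦ hnadj h.symm
  set f := adjInd G u with hfdef
  set g := adjInd G v with hgdef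
  have h0 : pathSum (adjInd G) = pathSumAux S (adjInd G) f g :=
    pathSum_eq_pathSumAux huv (adjInd_comm G) (adjInd_self G u) (adjInd_self G v)
      (by simp [adjInd, hnadj]) (fun x _ ↦ adjInd_comm G x u) (fun x _ ↦ adjInd_comm G x v)
      (fun _ _ _ _ ↦ rfl)
  have h1 : pathSum (adjInd (G.replaceVertex u v)) = pathSumAux S (adjInd G) f f := by
    refine pathSum_eq_pathSumAux huv (adjInd_comm _) (adjInd_self _ u) (adjInd_self _ v)
      ?_ (fun x hx ↦ ?_) (fun x hx ↦ ?_) (fun x hx y hy ↦ ?_)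
    · simp [adjInd, replaceVertex]
    · have := hmem.1 hx
      exact adjInd_congr (by simp [replaceVertex, this, huv, G.adj_comm])
    · have := hmem.1 hx
      exact adjInd_congr (by simp [replaceVertex, this, G.adj_comm])
    · have := hmem.1 hx
      have := hmem.1 hy
      exact adjInd_congr (by simp [replaceVertex, *])
  have h2 : pathSum (adjInd (G.replaceVertex v u)) = pathSumAux S (adjInd G) g g := by
    refine pathSum_eq_pathSumAux huv (adjInd_comm _) (adjInd_self _ u) (adjInd_self _ v)
      ?_ (fun x hx ↦ ?_) (fun x hx ↦ ?_) (fun x hx y hy ↦ ?_)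
    · simp [adjInd, replaceVertex]
    · have := hmem.1 hx
      exact adjInd_congr (by simp [replaceVertex, this, G.adj_comm])
    · have := hmem.1 hx
      exact adjInd_congr (by simp [replaceVertex, this, huv.symm, G.adj_comm])
    · have := hmem.1 hx
      have := hmem.1 hy
      exact adjInd_congr (by simp [replaceVertex, *])
  have hf (x) (_ : x ∈ S) := adjInd_eq_zero_or_one G u x
  have hg (x) (_ : x ∈ S) := adjInd_eq_zero_or_one G v x
  have h3 := pathSumAux_add_sub S (adjInd G) f g hf hg
  have h4 := neg_le_sum_sum_mul_sub_mul_sub S (adjInd G) f g hf hg (adjInd_eq_zero_or_one G)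
  have hdu : ∑ x, f x = ∑ x ∈ S, f x := by
    rw [sum_eq_add_add_sum_erase huv]; simp [hfdef, adjInd, hnadj, hS]
  have hdv : ∑ x, g x = ∑ x ∈ S, g x := by
    rw [sum_eq_add_add_sum_erase huv]; simp [hgdef, adjInd, hnadj', hS]
  rw [hdu, hdv] at hdeg
  have hFp : ∑ x ∈ S, f x = (∑ x ∈ S, f x * g x) + ∑ x ∈ S, f x * (1 - g x) := by
    rw [← sum_add_distrib]; exact sum_congr rfl fun x _ ↦ by ring
  have hGq : ∑ x ∈ S, g x = (∑ x ∈ S, f x * g x) + ∑ x ∈ S, g x * (1 - f x) := by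
    rw [← sum_add_distrib]; exact sum_congr rfl fun x _ ↦ by ring
  have hfn (x) : 0 ≤ f x := adjInd_nonneg G u x
  have hgn (x) : 0 ≤ g x := adjInd_nonneg G v x
  have hfl (x) : 0 ≤ 1 - f x := by rcases adjInd_eq_zero_or_one G u x with h | h <;> simp [hfdef, h]
  have hgl (x) : 0 ≤ 1 - g x := by rcases adjInd_eq_zero_or_one G v x with h | h <;> simp [hgdef, h]
  have hc : 0 ≤ ∑ x ∈ S, f x * g x := sum_nonneg fun x _ ↦ mul_nonneg (hfn x) (hgn x)
  have hp : 0 ≤ ∑ x ∈ S, f x * (1 - g x) := sum_nonneg fun x _ ↦ mul_nonneg (hfn x) (hgl x)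
  have hq : 0 ≤ ∑ x ∈ S, g x * (1 - f x) := sum_nonneg fun x _ ↦ mul_nonneg (hgn x) (hfl x)
  have hpq : 0 < (∑ x ∈ S, f x * (1 - g x)) + ∑ x ∈ S, g x * (1 - f x) := by
    rw [← sum_add_distrib]
    obtain ⟨x, hx⟩ := htwin
    have hxS : x ∈ S := by
      rw [hmem]
      constructor <;> rintro rfl <;> simp [hnadj, hnadj'] at hx
    refine sum_pos' (fun x _ ↦ add_nonneg (mul_nonneg (hfn x) (hgl x)) (mul_nonneg (hgn x) (hfl x)))
      ⟨x, hxS, ?_⟩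
    by_cases hu : G.Adj u x <;> by_cases hv : G.Adj v x <;>
      simp_all [adjInd]
  rw [h0, h1, h2]
  generalize ∑ x ∈ S, f x = a at *
  generalize ∑ x ∈ S, g x = b at *
  generalize ∑ x ∈ S, f x * g x = c at *
  generalize ∑ x ∈ S, f x * (1 - g x) = p at *
  generalize ∑ x ∈ S, g x * (1 - f x) = q at *
  subst hFp hGq
  -- Here `c` counts common and `p`, `q` private neighbours; the total gain is at least four times
  -- this quantity. For `c = 0` it vanishes at `p = q = 2`, hence the degree condition.
  have : 0 < (c + p) * p + (c + q) * q - (p + q) - p * q := by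
    rcases hc.eq_or_lt with rfl | hc1
    · rcases hdeg with h | h
      · nlinarith [sq_nonneg (p - 2 * q), sq_nonneg (2 * q - p - 1)]
      · nlinarith [sq_nonneg (q - 2 * p), sq_nonneg (2 * p - q - 1)]
    · nlinarith [sq_nonneg (p - q), mul_nonneg hp hq, mul_pos hpq hpq]
  linarith

end Symmetrization

/-! ### Complete tripartite graphs and balancing. -/

section Tripartite

/-- The number of injective walks with three edges in the complete tripartite graph with parts of
sizes `x`, `y`, `z`. -/
def tripartitePathCount (x y z : ℤ) : ℤ :=
  2 * (x * y * (y + z - 1) * (x + z - 1) + y * z * (x + z - 1) * (x + y - 1)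
    + x * z * (y + z - 1) * (x + y - 1)) - 6 * x * y * z

lemma tripartitePathCount_swap₁₂ (x y z : ℤ) :
    tripartitePathCount x y z = tripartitePathCount y x z := by
  unfold tripartitePathCount; ring

lemma tripartitePathCount_swap₂₃ (x y z : ℤ) :
    tripartitePathCount x y z = tripartitePathCount x z y := by
  unfold tripartitePathCount; ring

lemma tripartitePathCount_smooth (x y z : ℕ) (h : y + 1 ≤ x) :
    tripartitePathCount (x + 1 : ℕ) y z ≤ tripartitePathCount x (y + 1 : ℕ) z := by
  obtain ⟨δ, rfl⟩ := Nat.exists_eq_add_of_le h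
  have key : tripartitePathCount (y + 1 + δ : ℕ) (y + 1 : ℕ) z
      - tripartitePathCount (y + 1 + δ + 1 : ℕ) y z
      = 2 * (δ + 1) * (2 * y * (y + δ + 1) + z * (3 * (2 * y + δ + 2) + z - 7)) := by
    unfold tripartitePathCount; push_cast; ring
  -- For `z ≥ 1` the bracket is at least `3 * 2 + 1 - 7 = 0`.
  have hz : 0 ≤ (z : ℤ) * (3 * (2 * y + δ + 2) + z - 7) := by
    rcases Nat.eq_zero_or_pos z with rfl | hz
    · simp
    · exact mul_nonneg (by positivity) (by omega)
  have : 0 ≤ 2 * ((δ : ℤ) + 1) * (2 * y * (y + δ + 1) + z * (3 * (2 * y + δ + 2) + z - 7)) :=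
    mul_nonneg (by positivity) (add_nonneg (by positivity) hz)
  linarith

theorem tripartitePathCount_le (x y z : ℕ) :
    tripartitePathCount x y z ≤ tripartitePathCount ((x + y + z) / 3 : ℕ)
      ((x + y + z + 1) / 3 : ℕ) ((x + y + z + 2) / 3 : ℕ) := by
  -- Moving a vertex between parts whose sizes differ by at least two lowers the sum of squares.
  induction hk : x ^ 2 + y ^ 2 + z ^ 2 using Nat.strong_induction_on generalizing x y z with
  | _ k ih =>
  have step (x y z : ℕ) (hk : x ^ 2 + y ^ 2 + z ^ 2 = k) (hxy : y + 2 ≤ x) :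
      tripartitePathCount x y z ≤ tripartitePathCount ((x + y + z) / 3 : ℕ)
        ((x + y + z + 1) / 3 : ℕ) ((x + y + z + 2) / 3 : ℕ) := by
    obtain ⟨x, rfl⟩ : ∃ x', x = x' + 1 := ⟨x - 1, by omega⟩
    refine (tripartitePathCount_smooth x y z (by omega)).trans ?_
    have := ih (x ^ 2 + (y + 1) ^ 2 + z ^ 2) (by rw [← hk]; nlinarith) x (y + 1) z rfl
    rwa [show x + (y + 1) + z = x + 1 + y + z by ring] at this
  by_cases h1 : y + 2 ≤ x
  · exact step x y z hk h1
  by_cases h2 : x + 2 ≤ y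
  · have := step y x z (by rw [← hk]; ring) h2
    rwa [tripartitePathCount_swap₁₂, show y + x + z = x + y + z by ring] at this
  by_cases h3 : z + 2 ≤ x
  · have := step x z y (by rw [← hk]; ring) h3
    rwa [tripartitePathCount_swap₂₃, show x + z + y = x + y + z by ring] at this
  by_cases h4 : x + 2 ≤ z
  · have := step z x y (by rw [← hk]; ring) h4
    rwa [tripartitePathCount_swap₁₂, tripartitePathCount_swap₂₃,
      show z + x + y = x + y + z by ring] at this
  by_cases h5 : z + 2 ≤ y
  · have := step y z x (by rw [← hk]; ring) h5
    rwa [tripartitePathCount_swap₂₃, tripartitePathCount_swap₁₂,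
      show y + z + x = x + y + z by ring] at this
  by_cases h6 : y + 2 ≤ z
  · have := step z y x (by rw [← hk]; ring) h6
    rwa [tripartitePathCount_swap₁₂, tripartitePathCount_swap₂₃, tripartitePathCount_swap₁₂,
      show z + y + x = x + y + z by ring] at this
  refine le_of_eq ?_
  generalize ha : (x + y + z) / 3 = a
  generalize hb : (x + y + z + 1) / 3 = b
  generalize hc : (x + y + z + 2) / 3 = c
  obtain ⟨rfl, rfl, rfl⟩ | ⟨rfl, rfl, rfl⟩ | ⟨rfl, rfl, rfl⟩ | ⟨rfl, rfl, rfl⟩ | ⟨rfl, rfl, rfl⟩ |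
      ⟨rfl, rfl, rfl⟩ : (a = x ∧ b = y ∧ c = z) ∨ (a = x ∧ b = z ∧ c = y) ∨
      (a = y ∧ b = x ∧ c = z) ∨ (a = y ∧ b = z ∧ c = x) ∨ (a = z ∧ b = x ∧ c = y) ∨
      (a = z ∧ b = y ∧ c = x) := by omega
  all_goals unfold tripartitePathCount; ring

/-- Disposes of graphs with a vertex of degree at most two. The threshold is not sharp: writing `n`
in terms of `k + 10` lets `positivity` finish. -/
lemma cubic_le_tripartitePathCount (n : ℕ) (hn : 30 ≤ n) :
    2 * (n : ℤ) ^ 3 + 8 * n ≤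
      tripartitePathCount (n / 3 : ℕ) ((n + 1) / 3 : ℕ) ((n + 2) / 3 : ℕ) := by
  obtain ⟨k, hk⟩ : ∃ k, n = 3 * (k + 10) ∨ n = 3 * (k + 10) + 1 ∨ n = 3 * (k + 10) + 2 :=
    ⟨n / 3 - 10, by omega⟩
  rcases hk with rfl | rfl | rfl
  · rw [show 3 * (k + 10) / 3 = k + 10 by omega, show (3 * (k + 10) + 1) / 3 = k + 10 by omega,
      show (3 * (k + 10) + 2) / 3 = k + 10 by omega, ← sub_nonneg]
    unfold tripartitePathCount
    push_cast
    ring_nf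
    positivity
  · rw [show (3 * (k + 10) + 1) / 3 = k + 10 by omega,
      show (3 * (k + 10) + 1 + 1) / 3 = k + 10 by omega,
      show (3 * (k + 10) + 1 + 2) / 3 = k + 11 by omega, ← sub_nonneg]
    unfold tripartitePathCount
    push_cast
    ring_nf
    positivity
  · rw [show (3 * (k + 10) + 2) / 3 = k + 10 by omega,
      show (3 * (k + 10) + 2 + 1) / 3 = k + 11 by omega,
      show (3 * (k + 10) + 2 + 2) / 3 = k + 11 by omega, ← sub_nonneg]
    unfold tripartitePathCount
    push_cast
    ring_nf
    positivity

variable {V : Type*} [Fintype V]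

theorem pathSum_comap_top (col : V → Fin 3) :
    pathSum (adjInd ((⊤ : SimpleGraph (Fin 3)).comap col)) =
      tripartitePathCount #{x | col x = 0} #{x | col x = 1} #{x | col x = 2} := by
  set s : Fin 3 → ℤ := fun i ↦ #{x | col x = i} with hs
  -- Vertex sums collapse to sums over colours weighted by class sizes.
  have hsum (F : Fin 3 → ℤ) : ∑ x, F (col x) = ∑ i, s i * F i := by
    rw [← sum_fiberwise univ col]
    refine sum_congr rfl fun i _ ↦ ?_
    rw [sum_congr rfl fun x hx ↦ congrArg F (mem_filter.1 hx).2, sum_const, nsmul_eq_mul]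
  set E : Fin 3 → Fin 3 → ℤ := fun i j ↦ if i = j then 0 else 1 with hE
  have hA (x y : V) : adjInd ((⊤ : SimpleGraph (Fin 3)).comap col) x y = E (col x) (col y) := by
    by_cases h : col x = col y <;> simp [adjInd, hE, h]
  have hd (x : V) : ∑ z, E (col x) (col z) = ∑ j, s j * E (col x) j := hsum (E (col x))
  simp only [pathSum, hA, hd]
  rw [sum_congr rfl fun x _ ↦ hsum fun j ↦ E (col x) j * ((∑ k, s k * E (col x) k) *
      ∑ k, s k * E j k),
    hsum fun i ↦ ∑ j, s j * (E i j * ((∑ k, s k * E i k) * ∑ k, s k * E j k)),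
    hsum fun i ↦ (∑ j, s j * E i j) ^ 2, hsum fun i ↦ ∑ j, s j * E i j,
    sum_congr rfl fun x _ ↦ sum_congr rfl fun y _ ↦ hsum fun k ↦
      E (col x) (col y) * E (col y) k * E k (col x),
    sum_congr rfl fun x _ ↦ hsum fun j ↦ ∑ k, s k * (E (col x) j * E j k * E k (col x)),
    hsum fun i ↦ ∑ j, s j * ∑ k, s k * (E i j * E j k * E k i)]
  change _ = tripartitePathCount (s 0) (s 1) (s 2)
  simp [Fin.sum_univ_three, hE, tripartitePathCount]
  ring

theorem pathSum_comap_top_le (col : V → Fin 3) :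
    pathSum (adjInd ((⊤ : SimpleGraph (Fin 3)).comap col)) ≤
      tripartitePathCount (Fintype.card V / 3 : ℕ) ((Fintype.card V + 1) / 3 : ℕ)
        ((Fintype.card V + 2) / 3 : ℕ) := by
  have h : #{x | col x = 0} + #{x | col x = 1} + #{x | col x = 2} = Fintype.card V := by
    rw [← Fin.sum_univ_three fun i ↦ #{x | col x = i}, ← Finset.card_univ,
      card_eq_sum_card_fiberwise (s := univ) (f := col) (t := univ) (by simp)]
  rw [pathSum_comap_top, ← h]
  exact tripartitePathCount_le _ _ _

theorem pathSum_turanGraph (n : ℕ) :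
    pathSum (adjInd (turanGraph n 3)) =
      tripartitePathCount (n / 3 : ℕ) ((n + 1) / 3 : ℕ) ((n + 2) / 3 : ℕ) := by
  set col : Fin n → Fin 3 := fun x ↦ ⟨x % 3, Nat.mod_lt _ (by norm_num)⟩ with hcol
  have hT : turanGraph n 3 = (⊤ : SimpleGraph (Fin 3)).comap col := by
    ext x y
    simp [turanGraph, hcol]
  have hcard (i : Fin 3) : #{x | col x = i} = n / 3 + if (i : ℕ) < n % 3 then 1 else 0 := by
    have := Nat.count_modEq_card n (r := 3) (by norm_num) i
    rw [Nat.mod_eq_of_lt i.isLt] at this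
    rw [← this, Nat.count_eq_card_filter_range, card_filter, card_filter,
      ← Fin.sum_univ_eq_sum_range fun x ↦ if x ≡ i [MOD 3] then 1 else 0]
    refine sum_congr rfl fun x _ ↦ if_congr ?_ rfl rfl
    rw [Nat.ModEq, Nat.mod_eq_of_lt i.isLt, Fin.ext_iff]
  have h0 : #{x | col x = 0} = (n + 2) / 3 := by
    rw [hcard]; split_ifs with h <;> simp at h <;> omega
  have h1 : #{x | col x = 1} = (n + 1) / 3 := by
    rw [hcard]; split_ifs with h <;> simp at h <;> omega
  have h2 : #{x | col x = 2} = n / 3 := by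
    rw [hcard]; split_ifs with h <;> simp at h <;> omega
  rw [hT, pathSum_comap_top, h0, h1, h2]
  unfold tripartitePathCount
  ring

end Tripartite

/-! ### The extremal graph. -/

section Extremal

variable {V : Type*} [Fintype V]

/-- Not visible from the formula, which has negative terms; it follows by counting copies. -/
theorem pathSum_mono {G G' : SimpleGraph V} (h : G ≤ G') :
    pathSum (adjInd G) ≤ pathSum (adjInd G') := by
  have : Finite (Copy (pathGraph 4) G') :=
    Finite.of_injective _ (DFunLike.coe_injective (F := Copy (pathGraph 4) G'))
  rw [← labelledCopyCount_pathGraph_four, ← labelledCopyCount_pathGraph_four, labelledCopyCount,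
    labelledCopyCount, Nat.cast_le, Fintype.card_eq_nat_card, Fintype.card_eq_nat_card]
  refine Nat.card_le_card_of_injective (fun f ↦ (Copy.ofLE G G' h).comp f) fun f g hfg ↦ ?_
  ext x
  exact DFunLike.congr_fun hfg x

/-- `2 * d x * d y ≤ d x ^ 2 + d y ^ 2` on each edge bounds the main term; the remaining terms sum
to at most zero. -/
theorem pathSum_le_sum_degree_pow_three (G : SimpleGraph V) :
    pathSum (adjInd G) ≤ ∑ x, (∑ y, adjInd G x y) ^ 3 := by
  have h0 (x y) := adjInd_nonneg G x y
  set d : V → ℤ := fun x ↦ ∑ y, adjInd G x y with hd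
  have hd0 (x : V) : 0 ≤ d x := sum_nonneg fun y _ ↦ h0 x y
  have h1 : 2 * ∑ x, ∑ y, adjInd G x y * (d x * d y) ≤ 2 * ∑ x, d x ^ 3 := by
    have e1 : ∑ x, ∑ y, adjInd G x y * d x ^ 2 = ∑ x, d x ^ 3 := by
      refine sum_congr rfl fun x _ ↦ ?_
      rw [← sum_mul]
      change d x * d x ^ 2 = _
      ring
    have e2 : ∑ x, ∑ y, adjInd G x y * d y ^ 2 = ∑ x, d x ^ 3 := by
      rw [sum_comm, ← e1]
      exact sum_congr rfl fun x _ ↦ sum_congr rfl fun y _ ↦ by rw [adjInd_comm]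
    calc 2 * ∑ x, ∑ y, adjInd G x y * (d x * d y)
        ≤ ∑ x, ∑ y, (adjInd G x y * d x ^ 2 + adjInd G x y * d y ^ 2) := by
          simp only [mul_sum]
          exact sum_le_sum fun x _ ↦ sum_le_sum fun y _ ↦ by
            nlinarith [mul_nonneg (h0 x y) (sq_nonneg (d x - d y))]
      _ = 2 * ∑ x, d x ^ 3 := by
          simp only [sum_add_distrib, e1, e2]; ring
  have h2 : ∑ x, d x ≤ 2 * ∑ x, d x ^ 2 := by
    rw [mul_sum]
    refine sum_le_sum fun x _ ↦ ?_
    rcases (hd0 x).eq_or_lt with h | h <;> nlinarith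
  have h3 : 0 ≤ ∑ x, ∑ y, ∑ z, adjInd G x y * adjInd G y z * adjInd G z x :=
    sum_nonneg fun x _ ↦ sum_nonneg fun y _ ↦ sum_nonneg fun z _ ↦
      mul_nonneg (mul_nonneg (h0 _ _) (h0 _ _)) (h0 _ _)
  change (∑ x, ∑ y, adjInd G x y * (d x * d y)) - 2 * (∑ x, d x ^ 2) + (∑ x, d x) - _ ≤ _
  linarith

theorem sum_adjInd_le_card (G : SimpleGraph V) (x : V) : ∑ y, adjInd G x y ≤ Fintype.card V := by
  calc ∑ y, adjInd G x y ≤ ∑ _y : V, (1 : ℤ) := sum_le_sum fun y _ ↦ by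
        rcases adjInd_eq_zero_or_one G x y with h | h <;> simp [h]
    _ = Fintype.card V := by simp

/-- A vertex of degree at most two that is adjacent to all vertices of larger degree forces the
graph to have few three-edge paths. -/
theorem pathSum_le_of_low_degree (G : SimpleGraph V) (w : V) (hw : ∑ y, adjInd G w y ≤ 2)
    (h : ∀ v, 3 ≤ ∑ y, adjInd G v y → G.Adj w v) :
    pathSum (adjInd G) ≤ 2 * (Fintype.card V : ℤ) ^ 3 + 8 * Fintype.card V := by
  refine (pathSum_le_sum_degree_pow_three G).trans ?_
  calc ∑ x, (∑ y, adjInd G x y) ^ 3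
      ≤ ∑ x, (adjInd G w x * (Fintype.card V : ℤ) ^ 3 + 8) := by
        refine sum_le_sum fun x _ ↦ ?_
        have hx0 : 0 ≤ ∑ y, adjInd G x y := sum_nonneg fun y _ ↦ adjInd_nonneg G x y
        by_cases hx : 3 ≤ ∑ y, adjInd G x y
        · have : adjInd G w x = 1 := by simp [adjInd, h x hx]
          rw [this]
          have := pow_le_pow_left₀ hx0 (sum_adjInd_le_card G x) 3
          linarith
        · have h2 : ∑ y, adjInd G x y ≤ 2 := by omega
          have := pow_le_pow_left₀ hx0 h2 3
          have : 0 ≤ adjInd G w x * (Fintype.card V : ℤ) ^ 3 :=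
            mul_nonneg (adjInd_nonneg G w x) (by positivity)
          linarith
    _ = (∑ x, adjInd G w x) * (Fintype.card V : ℤ) ^ 3 + 8 * Fintype.card V := by
        rw [sum_add_distrib, sum_mul]; simp [mul_comm]
    _ ≤ _ := by gcongr

/-- Among `K₄`-free graphs on at least thirty vertices, the balanced complete tripartite graph has
the most three-edge paths. -/
theorem CliqueFree.pathSum_le {G : SimpleGraph V} (hG : G.CliqueFree 4)
    (hV : 30 ≤ Fintype.card V) :
    pathSum (adjInd G) ≤ tripartitePathCount (Fintype.card V / 3 : ℕ)
      ((Fintype.card V + 1) / 3 : ℕ) ((Fintype.card V + 2) / 3 : ℕ) := by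
  classical
  obtain ⟨M, hM, hmax⟩ := exists_max_image (univ.filter fun G : SimpleGraph V ↦ G.CliqueFree 4)
    (fun G ↦ pathSum (adjInd G)) ⟨G, by simpa using hG⟩
  simp only [mem_filter, mem_univ, true_and] at hM hmax
  refine (hmax G hG).trans ?_
  have htwin (u v : V) (huv : u ≠ v) (hn : ¬ M.Adj u v)
      (hdeg : 3 ≤ ∑ x, adjInd M u x ∨ 3 ≤ ∑ x, adjInd M v x) (x : V) :
      M.Adj u x ↔ M.Adj v x := by
    by_contra hx
    have := pathSum_lt_of_not_adj M huv hn hdeg ⟨x, hx⟩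
    have := hmax _ (hM.replaceVertex u v)
    have := hmax _ (hM.replaceVertex v u)
    linarith
  by_cases hlow : ∃ w, ∑ y, adjInd M w y ≤ 2
  · obtain ⟨w, hw⟩ := hlow
    refine (pathSum_le_of_low_degree M w hw fun v hv ↦ ?_).trans (cubic_le_tripartitePathCount _ hV)
    by_contra hn
    -- If not adjacent, `w` and `v` would be twins of different degrees.
    have hne : w ≠ v := by rintro rfl; omega
    have := htwin w v hne hn (.inr hv)
    have : ∑ y, adjInd M w y = ∑ y, adjInd M v y := sum_congr rfl fun y _ ↦ adjInd_congr (this y)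
    omega
  · push Not at hlow
    have hmp : M.IsCompleteMultipartite := ⟨fun u v w huv hvw ↦ by
      rcases eq_or_ne u v with rfl | hne
      · exact hvw
      · rwa [htwin u v hne huv (.inl (hlow u))]⟩
    obtain ⟨col⟩ := hmp.colorable_of_cliqueFree hM
    -- Colour classes may be empty, so fewer than three parts are covered too.
    refine (pathSum_mono (G' := (⊤ : SimpleGraph (Fin 3)).comap col) fun x y hxy ↦ ?_).trans
      (pathSum_comap_top_le col)
    exact col.valid hxy

end Extremal

theorem copyCount_pathGraph_four_le_turanGraph {n : ℕ} (hn : 30 ≤ n) {G : SimpleGraph (Fin n)}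
    (hG : G.CliqueFree 4) :
    G.copyCount (pathGraph 4) ≤ (turanGraph n 3).copyCount (pathGraph 4) := by
  rw [copyCount_le_copyCount_iff, ← Nat.cast_le (α := ℤ), labelledCopyCount_pathGraph_four,
    labelledCopyCount_pathGraph_four, pathSum_turanGraph]
  simpa using hG.pathSum_le (by simpa using hn)

lemma completeGraph_four_free_pathGraph_four : (completeGraph (Fin 4)).Free (pathGraph 4) := by
  rintro ⟨f⟩
  -- A copy would be bijective on vertices, making the path's nonadjacent vertices `0` and `2`
  -- adjacent.
  obtain ⟨i, hi⟩ := (Finite.injective_iff_surjective.1 f.injective) 0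
  obtain ⟨j, hj⟩ := (Finite.injective_iff_surjective.1 f.injective) 2
  have hij : i ≠ j := by rintro rfl; rw [hi] at hj; revert hj; decide
  have := f.toHom.map_adj (show (completeGraph (Fin 4)).Adj i j from hij)
  rw [hi, hj, pathGraph_adj] at this
  revert this
  decide

end SimpleGraph

theorem mainTheorem9 : IsKTuranGood 4 (pathGraph 4) := by
  refine ⟨4, by norm_num, by simp,
    completeGraph_four_free_pathGraph_four, 30, fun n hn ↦ ?_⟩
  have hfree (G : SimpleGraph (Fin n)) : (completeGraph (Fin 4)).Free G ↔ G.CliqueFree 4 :=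
    by simpa using (cliqueFree_iff_top_free (G := G) (β := Fin 4)).symm
  classical
  refine le_antisymm (Finset.sup_le fun G hG ↦ ?_) ?_
  · exact copyCount_pathGraph_four_le_turanGraph hn ((hfree G).1 (Finset.mem_filter.1 hG).2)
  · exact Finset.le_sup (f := fun G : SimpleGraph (Fin n) ↦ G.copyCount (pathGraph 4))
      (Finset.mem_filter.2 ⟨Finset.mem_univ _,
        (hfree _).2 (turanGraph_cliqueFree (by norm_num))⟩)
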